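/- For $\lambda \in \mathbb{C}\setminus\{0,1\}$ let $E_\lambda$ be the elliptic curve $y^2 = x(x-1)(x-\lambda)$ over $\mathbb{C}$. For $\alpha \in \mathbb{C}$ let $T(\alpha)$ be the set of all $\lambda \in \mathbb{C}\setminus\{0,1\}$ such that a point of $E_\lambda$ with $x$-coordinate $\alpha$ is a torsion point (this does not depend on the choice of the point). Let $\boldsymbol\mu \subseteq \mathbb{C}$ be the set of all roots of unity, and write $\operatorname{ord}(\alpha)$ for the multiplicative order of $\alpha \in \boldsymbol\mu$. 1. If $\alpha \in \boldsymbol\mu$ and $\alpha \neq 1$, then \[ T(\alpha) \cap \boldsymbol\mu = \begin{cases} \{\alpha\} & \text{if } \alpha = -1, \\ \{\alpha, \alpha^2, -\alpha^2\} & \text{if } \operatorname{ord}(\alpha) \in \{3,6,12\}, \\ \{\alpha, \alpha^2\} & \text{otherwise.} \end{cases} \] 2. $T(2) \cap \boldsymbol\mu = \emptyset$. 3. $\max_{\alpha \in \mathbb{C} \setminus \{0,1\}} \#\bigl(T(\alpha) \cap \boldsymbol\mu\bigr) = 3$, and for $\alpha \in \mathbb{C}\setminus\{0,1\}$ one has $\#\bigl(T(\alpha)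 \cap \boldsymbol\mu\bigr) = 3$ if and only if $\alpha$ is one of the roots of $x^8 + x^4 + 1$, which has exactly eight distinct complex roots. -/

import Mathlib

noncomputable section

/-- The Legendre curve `E_l : y² = x(x - 1)(x - l) = x³ - (1 + l) x² + l x` over `ℂ`. -/
def legendreCurve (l : ℂ) : WeierstrassCurve.Affine ℂ where
  a₁ := 0
  a₂ := -(1 + l)
  a₃ := 0
  a₄ := l
  a₆ := 0

/-- Sanity check: the affine equation is the Legendre equation. -/
theorem legendreCurve_equation_iff (l x y : ℂ) :
    (legendreCurve l).Equation x y ↔ y ^ 2 = x * (x - 1) * (x - l) := by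
  rw [WeierstrassCurve.Affine.equation_iff]
  simp only [legendreCurve]
  constructor <;> intro h <;> linear_combination h

/-- `T(α)`: the parameters `l ∈ ℂ ∖ {0, 1}` such that a point of `E_l` with `x`-coordinate `α`
is a torsion point. -/
def legendreT (α : ℂ) : Set ℂ :=
  {l : ℂ | l ≠ 0 ∧ l ≠ 1 ∧
    ∃ (y : ℂ) (h : (legendreCurve l).Nonsingular α y),
      IsOfFinAddOrder (WeierstrassCurve.Affine.Point.some α y h)}

/-- Every complex number is the `x`-coordinate of a point of `E_l` when `l ≠ 0, 1`. -/
theorem exists_nonsingular_legendreCurve {l : ℂ} (h0 : l ≠ 0) (h1 : l ≠ 1) (α : ℂ) :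
    ∃ y : ℂ, (legendreCurve l).Nonsingular α y := by
  obtain ⟨y, hy⟩ := IsAlgClosed.exists_pow_nat_eq (α * (α - 1) * (α - l)) (n := 2) (by norm_num)
  refine ⟨y, (WeierstrassCurve.Affine.equation_iff_nonsingular_of_Δ_ne_zero ?_).1
    ((legendreCurve_equation_iff l α y).2 hy)⟩
  have : (legendreCurve l).Δ = 16 * l ^ 2 * (l - 1) ^ 2 := by
    simp only [legendreCurve, WeierstrassCurve.Δ, WeierstrassCurve.b₂, WeierstrassCurve.b₄,
      WeierstrassCurve.b₆, WeierstrassCurve.b₈]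
    ring
  rw [this]
  exact mul_ne_zero (mul_ne_zero (by norm_num) (pow_ne_zero 2 h0))
    (pow_ne_zero 2 (sub_ne_zero.2 h1))

/-- `T(α)` does not depend on the choice of the point with `x`-coordinate `α`. -/
theorem mem_legendreT_iff_forall (α l : ℂ) :
    l ∈ legendreT α ↔ l ≠ 0 ∧ l ≠ 1 ∧
      ∀ (y : ℂ) (h : (legendreCurve l).Nonsingular α y),
        IsOfFinAddOrder (WeierstrassCurve.Affine.Point.some α y h) := by
  constructor
  · rintro ⟨h0, h1, y, h, ht⟩
    refine ⟨h0, h1, fun y' h' => ?_⟩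
    rcases WeierstrassCurve.Affine.Y_eq_of_X_eq h'.1 h.1 rfl with hy | hy
    · subst hy
      exact ht
    · subst hy
      have := ht.neg
      rwa [WeierstrassCurve.Affine.Point.neg_some] at this
  · rintro ⟨h0, h1, h⟩
    obtain ⟨y, hy⟩ := exists_nonsingular_legendreCurve h0 h1 α
    exact ⟨h0, h1, y, hy, h y hy⟩

/-- The set `μ` of all complex roots of unity. -/
def complexRootsOfUnity : Set ℂ := {z : ℂ | IsOfFinOrder z}

end

/-! Everything rests on integrality at the places above 2. If λ is integral there, a torsion point
has integral x-coordinate: otherwise doubling would strictly enlarge the x-coordinate forever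
(`valuation_lt_valuation_legendreDouble`), while a torsion point has finitely many multiples.
Applied to P and 2P, the duplication formula then makes (α² - λ)/2 integral at 2
(`half_mem_of_mem_legendreT`). For roots of unity α and λ ≠ α, this is an algebraic integer whose
conjugates all have absolute value at most 1, so Kronecker's theorem leaves only λ = ±α². For λ =
-α², integrality of x(4P) makes (α⁸ + α⁴ + 1)/4 an algebraic integer with conjugates of size at most
3/4, hence zero; conversely, each factor of α⁸ + α⁴ + 1 gives explicit torsion. If α is not a root
of unity, subtracting the conditions for λ and λ' eliminates α and gives λ' = ±λ, so at most two
values occur. -/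

/-! ### Doubling on the Legendre curve -/

open WeierstrassCurve.Affine in
theorem legendreCurve_negY (l x y : ℂ) : (legendreCurve l).negY x y = -y := by
  simp [negY, legendreCurve]

open WeierstrassCurve.Affine in
theorem legendreCurve_add_self_of_Y_zero {l x y : ℂ} (h : (legendreCurve l).Nonsingular x y)
    (hy : y = 0) : Point.some x y h + Point.some x y h = 0 :=
  Point.add_self_of_Y_eq (by rw [legendreCurve_negY, hy, neg_zero])

/-- The `x`-coordinate of twice a point with `x`-coordinate `x` on the Legendre curve. -/
noncomputable def legendreDouble (l x : ℂ) : ℂ := (x ^ 2 - l) ^ 2 / (4 * (x * (x - 1) * (x - l)))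

open WeierstrassCurve.Affine in
theorem legendreCurve_exists_add_self {l x y : ℂ} (h : (legendreCurve l).Nonsingular x y)
    (hy : y ≠ 0) : ∃ (y' : ℂ) (h' : (legendreCurve l).Nonsingular (legendreDouble l x) y'),
      Point.some x y h + Point.some x y h = Point.some (legendreDouble l x) y' h' := by
  have hne : y ≠ (legendreCurve l).negY x y := by
    rw [legendreCurve_negY]
    exact fun h' => hy (self_eq_neg.1 h')
  have heq := (legendreCurve_equation_iff l x y).1 h.1
  have hX : (legendreCurve l).addX x x ((legendreCurve l).slope x x y y)
      = legendreDouble l x := by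
    rw [slope_of_Y_ne rfl hne, legendreCurve_negY, addX, legendreDouble, ← heq]
    simp only [legendreCurve]
    field_simp
    ring_nf
    have e4 : y ^ 2 = l * x - l * x ^ 2 - x ^ 2 + x ^ 3 := by rw [heq]; ring
    rw [e4]
    ring
  have key := Point.add_self_of_Y_ne (h₁ := h) hne
  rw [key]
  generalize_proofs pf
  revert pf
  rw [hX]
  exact fun pf => ⟨_, pf, rfl⟩

theorem mem_legendreT_of_root {l x : ℂ} (h0 : l ≠ 0) (h1 : l ≠ 1)
    (hx : x * (x - 1) * (x - l) = 0) : l ∈ legendreT x := by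
  obtain ⟨y, h⟩ := exists_nonsingular_legendreCurve h0 h1 x
  have hy : y = 0 := by
    have := (legendreCurve_equation_iff l x y).1 h.1
    rw [hx] at this
    exact pow_eq_zero_iff two_ne_zero |>.1 this
  refine ⟨h0, h1, y, h, isOfFinAddOrder_iff_nsmul_eq_zero.2 ⟨2, two_pos, ?_⟩⟩
  rw [two_nsmul, legendreCurve_add_self_of_Y_zero h hy]

theorem legendreCurve_Y_ne_zero {l x y : ℂ} (h : (legendreCurve l).Nonsingular x y)
    (hx : x * (x - 1) * (x - l) ≠ 0) : y ≠ 0 := by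
  rintro rfl
  have := (legendreCurve_equation_iff l x 0).1 h.1
  exact hx (by rw [← this]; ring)

theorem mem_legendreT_double_iff {l x : ℂ} (hx : x * (x - 1) * (x - l) ≠ 0) :
    l ∈ legendreT (legendreDouble l x) ↔ l ∈ legendreT x := by
  have key : ∀ (y : ℂ) (h : (legendreCurve l).Nonsingular x y), ∃ (y' : ℂ)
      (h' : (legendreCurve l).Nonsingular (legendreDouble l x) y'),
      2 • WeierstrassCurve.Affine.Point.some x y h =
        WeierstrassCurve.Affine.Point.some _ y' h' := fun y h => by
    simpa only [two_nsmul] using legendreCurve_exists_add_self h (legendreCurve_Y_ne_zero h hx)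
  constructor
  · intro hl
    obtain ⟨h0, h1, hall⟩ := (mem_legendreT_iff_forall _ l).1 hl
    obtain ⟨y, h⟩ := exists_nonsingular_legendreCurve h0 h1 x
    obtain ⟨y', h', e⟩ := key y h
    refine ⟨h0, h1, y, h, IsOfFinAddOrder.of_nsmul (n := 2) ?_ two_ne_zero⟩
    rw [e]
    exact hall y' h'
  · rintro ⟨h0, h1, y, h, ht⟩
    obtain ⟨y', h', e⟩ := key y h
    exact ⟨h0, h1, y', h', e ▸ ht.nsmul⟩

theorem mem_legendreT_of_double_eq_self {l x : ℂ} (h0 : l ≠ 0) (h1 : l ≠ 1)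
    (hx : x * (x - 1) * (x - l) ≠ 0) (hd : legendreDouble l x = x) : l ∈ legendreT x := by
  obtain ⟨y, h⟩ := exists_nonsingular_legendreCurve h0 h1 x
  obtain ⟨y', h', e⟩ := legendreCurve_exists_add_self h (legendreCurve_Y_ne_zero h hx)
  refine ⟨h0, h1, y, h, ?_⟩
  set P := WeierstrassCurve.Affine.Point.some x y h
  rcases (WeierstrassCurve.Affine.Point.X_eq_iff (h₁ := h') (h₂ := h)).1 hd with e' | e'
  · rw [e'] at e
    have : P = 0 := add_eq_left.1 e
    rw [this]
    exact IsOfFinAddOrder.zero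
  · rw [e'] at e
    refine isOfFinAddOrder_iff_nsmul_eq_zero.2 ⟨3, by norm_num, ?_⟩
    rw [succ_nsmul, two_nsmul, e, neg_add_cancel]

/-! ### Integrality of torsion at places above 2 -/

/-- The term x dominates 1 and l, so doubling divides the size of x by |4| < 1. -/
theorem valuation_lt_valuation_legendreDouble {A : ValuationSubring ℂ} (h2 : A.valuation 2 < 1)
    {l x : ℂ} (hl : l ∈ A) (hx : 1 < A.valuation x) :
    A.valuation x < A.valuation (legendreDouble l x) := by
  have hl' := (A.valuation_le_one_iff l).2 hl
  have hx0 : 0 < A.valuation x := zero_lt_one.trans hx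
  have e1 : A.valuation (x ^ 2 - l) = A.valuation x ^ 2 := by
    rw [Valuation.map_sub_eq_of_lt_left, map_pow]
    rw [map_pow]
    exact hl'.trans_lt (one_lt_pow₀ hx two_ne_zero)
  have e2 : A.valuation (x - 1) = A.valuation x :=
    Valuation.map_sub_eq_of_lt_left _ (by rwa [map_one])
  have e3 : A.valuation (x - l) = A.valuation x :=
    Valuation.map_sub_eq_of_lt_left _ (hl'.trans_lt hx)
  have h4 : A.valuation 4 < 1 := by
    rw [show (4 : ℂ) = 2 ^ 2 by norm_num, map_pow]
    exact pow_lt_one₀ zero_le h2 two_ne_zero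
  have h40 : 0 < A.valuation 4 := (Valuation.pos_iff _).2 (by norm_num)
  rw [legendreDouble, map_div₀, map_pow, map_mul, map_mul, map_mul, e1, e2, e3,
    lt_div_iff₀ (by positivity)]
  calc A.valuation x * (A.valuation 4 * (A.valuation x * A.valuation x * A.valuation x))
      = A.valuation 4 * (A.valuation x ^ 2) ^ 2 := by
        simp only [pow_two]; ac_rfl
    _ < 1 * (A.valuation x ^ 2) ^ 2 := by
        exact mul_lt_mul_of_pos_right h4 (pow_pos (pow_pos hx0 2) 2)
    _ = _ := one_mul _

theorem mem_valuationSubring_of_mem_legendreT {A : ValuationSubring ℂ} (h2 : A.valuation 2 < 1)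
    {l x : ℂ} (hl : l ∈ A) (hx : l ∈ legendreT x) : x ∈ A := by
  by_contra hxA
  rw [← A.valuation_le_one_iff, not_le] at hxA
  obtain ⟨-, -, y, h, ht⟩ := hx
  obtain ⟨Q, hQ, hmax⟩ := Set.exists_max_image _
    (fun Q : (legendreCurve l).Point => A.valuation (Q.xRep 0))
    (finite_multiples.2 ht) ⟨_, AddSubmonoid.mem_multiples _⟩
  have hPQ := hmax _ (AddSubmonoid.mem_multiples _)
  -- The point at infinity has `xRep 0 = 1`, so it cannot be maximal when |x| > 1.
  rcases Q with _ | ⟨x', y', h'⟩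
  · have : A.valuation x ≤ 1 := by
      have h0 : A.valuation ((0 : (legendreCurve l).Point).xRep 0) = 1 := by simp
      exact (show A.valuation x ≤ A.valuation ((0 : (legendreCurve l).Point).xRep 0) from hPQ).trans
        h0.le
    exact absurd hxA this.not_gt
  · have hxx : A.valuation x ≤ A.valuation x' := by simpa using hPQ
    have hx' := hxA.trans_le hxx
    have hv := valuation_lt_valuation_legendreDouble h2 hl hx'
    have hy' : y' ≠ 0 := by
      -- A zero denominator would give `legendreDouble` the default value 0, which cannot exceed
      -- |x'|.
      refine legendreCurve_Y_ne_zero h' fun h0 => ?_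
      simp [legendreDouble, h0] at hv
    obtain ⟨y'', h'', e⟩ := legendreCurve_exists_add_self h' hy'
    have := hmax _ (e ▸ AddSubmonoid.add_mem _ hQ hQ)
    simp only [WeierstrassCurve.Affine.Point.xRep_some, Matrix.cons_val_zero] at this
    exact absurd hv this.not_gt

theorem ValuationSubring.mem_of_sq_mem {K : Type*} [Field K] {A : ValuationSubring K} {z : K}
    (h : z ^ 2 ∈ A) : z ∈ A := by
  rw [← A.valuation_le_one_iff] at h ⊢
  rw [map_pow] at h
  exact (pow_le_one_iff two_ne_zero).1 h

theorem half_mem_of_mem_legendreT {A : ValuationSubring ℂ} (h2 : A.valuation 2 < 1)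
    {l x : ℂ} (hl : l ∈ A) (hx : l ∈ legendreT x) (hx0 : x * (x - 1) * (x - l) ≠ 0) :
    (x ^ 2 - l) / 2 ∈ A := by
  have hxA := mem_valuationSubring_of_mem_legendreT h2 hl hx
  have hd := mem_valuationSubring_of_mem_legendreT h2 hl ((mem_legendreT_double_iff hx0).2 hx)
  refine ValuationSubring.mem_of_sq_mem ?_
  have : ((x ^ 2 - l) / 2) ^ 2 = legendreDouble l x * (x * (x - 1) * (x - l)) := by
    rw [legendreDouble, mul_comm (4 : ℂ), ← div_div, div_right_comm, div_mul_cancel₀ _ hx0]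
    ring
  rw [this]
  exact mul_mem hd (mul_mem (mul_mem hxA (sub_mem hxA A.one_mem)) (sub_mem hxA hl))

/-! ### From valuation rings to algebraic integers -/

theorem ValuationSubring.mem_of_isIntegral_int {K : Type*} [Field K] (A : ValuationSubring K)
    {z : K} (h : IsIntegral ℤ z) : z ∈ A := by
  obtain ⟨y, hy⟩ := IsIntegrallyClosed.isIntegral_iff.1 (h.tower_top (A := A))
  exact hy ▸ y.2

/-- The valuation rings of a field intersect in the integral closure of its prime ring, here the
closure of the empty set. -/
theorem isIntegral_int_of_forall_mem {K : Type*} [Field K] {z : K}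
    (h : ∀ A : ValuationSubring K, z ∈ A) : IsIntegral ℤ z := by
  have hz : z ∈ (⨅ V : {V : ValuationSubring K // (∅ : Set K) ⊆ V.toSubring},
      V.1.toSubring) := by
    simp only [Subring.mem_iInf]
    exact fun V => h V.1
  rw [iInf_valuationSubring_superset] at hz
  have hz' : IsIntegral (Subring.closure (∅ : Set K)) z := hz
  have : Algebra.IsIntegral ℤ (Subring.closure (∅ : Set K)) := by
    refine ⟨fun ⟨y, hy⟩ => ?_⟩
    rw [Subring.closure_empty] at hy
    obtain ⟨n, rfl⟩ := Subring.mem_bot.1 hy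
    have : (⟨(n : K), by assumption⟩ : Subring.closure (∅ : Set K)) = algebraMap ℤ _ n := by
      ext; simp
    exact isIntegral_algebraMap
  exact isIntegral_trans z hz'

theorem isIntegral_half_of_forall_mem {z : ℂ} (hz : IsIntegral ℤ z)
    (h : ∀ A : ValuationSubring ℂ, A.valuation 2 < 1 → z / 2 ∈ A) : IsIntegral ℤ (z / 2) := by
  refine isIntegral_int_of_forall_mem fun A => ?_
  have h2 : A.valuation 2 ≤ 1 := (A.valuation_le_one_iff 2).2 (ofNat_mem A 2)
  rcases h2.lt_or_eq with h2 | h2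
  · exact h A h2
  · rw [← A.valuation_le_one_iff, map_div₀, h2, div_one, A.valuation_le_one_iff]
    exact A.mem_of_isIntegral_int hz

/-! ### Kronecker's theorem and roots of unity -/

theorem IsOfFinOrder.isIntegral_int {z : ℂ} (h : IsOfFinOrder z) : IsIntegral ℤ z := by
  obtain ⟨n, hn, e⟩ := isOfFinOrder_iff_pow_eq_one.1 h
  exact IsIntegral.of_pow hn (e ▸ isIntegral_one)

open IntermediateField in
theorem numberField_adjoin_pair {a b : ℂ} (ha : IsIntegral ℤ a) (hb : IsIntegral ℤ b) :
    NumberField (adjoin ℚ {a, b}) where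
  to_charZero := inferInstance
  to_finiteDimensional := by
    refine finiteDimensional_adjoin fun x hx => ?_
    rcases hx with rfl | rfl
    · exact ha.tower_top
    · exact hb.tower_top

theorem eq_zero_of_norm_embedding_le_one {K : IntermediateField ℚ ℂ} [NumberField K] {x : K}
    (hx : IsIntegral ℤ (x : ℂ)) (h : ∀ σ : K →+* ℂ, ‖σ x‖ ≤ 1) (h1 : ‖(x : ℂ)‖ < 1) :
    (x : ℂ) = 0 := by
  by_contra h0
  have hxi : IsIntegral ℤ x :=
    (isIntegral_algHom_iff (K.val.restrictScalars ℤ) K.val.injective).1 hx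
  obtain ⟨n, hn, e⟩ := NumberField.Embeddings.pow_eq_one_of_norm_le_one K ℂ
    (fun h' => h0 (by rw [h']; rfl)) hxi h
  have e' : (x : ℂ) ^ n = 1 := by
    have := congrArg (K.val) e
    simpa using this
  exact h1.ne (Complex.norm_eq_one_of_pow_eq_one e' hn.ne')

theorem norm_ringHom_eq_one {K : IntermediateField ℚ ℂ} {z : K} (h : IsOfFinOrder (z : ℂ))
    (σ : K →+* ℂ) : ‖σ z‖ = 1 := by
  obtain ⟨n, hn, e⟩ := isOfFinOrder_iff_pow_eq_one.1 h
  have e' : z ^ n = 1 := Subtype.ext (by simpa using e)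
  exact Complex.norm_eq_one_of_pow_eq_one (n := n) (by rw [← map_pow, e', map_one]) hn.ne'

open IntermediateField in
theorem eq_or_eq_neg_of_isIntegral_half_sub {a b : ℂ} (ha : IsOfFinOrder a) (hb : IsOfFinOrder b)
    (h : IsIntegral ℤ ((a - b) / 2)) : b = a ∨ b = -a := by
  let K := adjoin ℚ {a, b}
  have : NumberField K := numberField_adjoin_pair ha.isIntegral_int hb.isIntegral_int
  let a' : K := ⟨a, subset_adjoin _ _ (by simp)⟩
  let b' : K := ⟨b, subset_adjoin _ _ (by simp)⟩
  have hna : ‖a‖ = 1 := ha.norm_eq_one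
  have hnb : ‖b‖ = 1 := hb.norm_eq_one
  by_cases hlt : ‖(a - b) / 2‖ < 1
  · left
    have hz : (((a' - b') / 2 : K) : ℂ) = 0 := by
      refine eq_zero_of_norm_embedding_le_one (x := (a' - b') / 2) h (fun σ => ?_) hlt
      have h1 : ‖σ a'‖ = 1 := norm_ringHom_eq_one ha σ
      have h2 : ‖σ b'‖ = 1 := norm_ringHom_eq_one hb σ
      have h3 := norm_sub_le (σ a') (σ b')
      rw [map_div₀, map_sub, map_ofNat, norm_div, Complex.norm_ofNat]
      linarith
    have hz' : (a - b) / 2 = 0 := hz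
    linear_combination -2 * hz'
  · right
    rw [norm_div, Complex.norm_ofNat, not_lt] at hlt
    -- Extremal case: |a - b| ≥ 2 on the unit circle forces a + b = 0.
    have hp := parallelogram_law_with_norm ℝ a b
    rw [hna, hnb] at hp
    have : ‖a + b‖ = 0 := by nlinarith [norm_nonneg (a + b), norm_nonneg (a - b)]
    linear_combination norm_eq_zero.1 this

open IntermediateField in
theorem eq_zero_of_isIntegral_quarter {a : ℂ} (ha : IsOfFinOrder a)
    (h : IsIntegral ℤ ((a ^ 8 + a ^ 4 + 1) / 4)) : a ^ 8 + a ^ 4 + 1 = 0 := by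
  let K := adjoin ℚ {a, a}
  have : NumberField K := numberField_adjoin_pair ha.isIntegral_int ha.isIntegral_int
  let a' : K := ⟨a, subset_adjoin _ _ (by simp)⟩
  have bound : ∀ z : ℂ, ‖z‖ = 1 → ‖(z ^ 8 + z ^ 4 + 1) / 4‖ < 1 := fun z hz => by
    have := norm_add₃_le (a := z ^ 8) (b := z ^ 4) (c := 1)
    rw [norm_pow, norm_pow, hz, norm_one] at this
    rw [norm_div, Complex.norm_ofNat]
    linarith
  have hz : (((a' ^ 8 + a' ^ 4 + 1) / 4 : K) : ℂ) = 0 := by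
    refine eq_zero_of_norm_embedding_le_one (x := (a' ^ 8 + a' ^ 4 + 1) / 4) h (fun σ => ?_)
      (bound a ha.norm_eq_one)
    simpa only [map_div₀, map_add, map_pow, map_one, map_ofNat] using
      (bound (σ a') (norm_ringHom_eq_one ha σ)).le
  have hz' : (a ^ 8 + a ^ 4 + 1) / 4 = 0 := hz
  linear_combination 4 * hz'

theorem IsOfFinOrder.ne_zero_complex {z : ℂ} (h : IsOfFinOrder z) : z ≠ 0 := by
  rintro rfl
  simpa using h.norm_eq_one

theorem mul_sub_ne_zero {a l : ℂ} (h0 : a ≠ 0) (h1 : a ≠ 1) (hl : a ≠ l) :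
    a * (a - 1) * (a - l) ≠ 0 :=
  mul_ne_zero (mul_ne_zero h0 (sub_ne_zero.2 h1)) (sub_ne_zero.2 hl)

theorem eq_of_mem_legendreT {a l : ℂ} (ha : IsOfFinOrder a) (ha1 : a ≠ 1) (hl : IsOfFinOrder l)
    (h : l ∈ legendreT a) : l = a ∨ l = a ^ 2 ∨ l = -a ^ 2 := by
  rcases eq_or_ne l a with hla | hla
  · exact Or.inl hla
  · refine Or.inr (eq_or_eq_neg_of_isIntegral_half_sub ha.pow hl
      (isIntegral_half_of_forall_mem ((ha.isIntegral_int.pow 2).sub hl.isIntegral_int)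
        fun A h2 => ?_))
    exact half_mem_of_mem_legendreT h2 (A.mem_of_isIntegral_int hl.isIntegral_int) h
      (mul_sub_ne_zero ha.ne_zero_complex ha1 hla.symm)

/-! ### The candidates α² and -α² -/

theorem legendreDouble_self_sq {a : ℂ} : legendreDouble (a ^ 2) a = 0 := by
  simp [legendreDouble]

theorem legendreDouble_neg_sq {a : ℂ} (h0 : a ≠ 0) (h1 : a ^ 2 ≠ 1) :
    legendreDouble (-a ^ 2) a = a ^ 2 / (a ^ 2 - 1) := by
  have h2 : a ^ 2 - 1 ≠ 0 := sub_ne_zero.2 h1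
  have h3 : a * (a - 1) * (a - -a ^ 2) = a ^ 2 * (a ^ 2 - 1) := by ring
  rw [legendreDouble, h3]
  field_simp
  ring

theorem neg_sq_mul_sub {a : ℂ} (h1 : a ^ 2 ≠ 1) :
    a ^ 2 / (a ^ 2 - 1) * (a ^ 2 / (a ^ 2 - 1) - 1) * (a ^ 2 / (a ^ 2 - 1) - -a ^ 2) =
      a ^ 6 / (a ^ 2 - 1) ^ 3 := by
  have h2 : a ^ 2 - 1 ≠ 0 := sub_ne_zero.2 h1
  field_simp
  ring

theorem legendreDouble_legendreDouble_neg_sq {a : ℂ} (h0 : a ≠ 0) (h1 : a ^ 2 ≠ 1) :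
    legendreDouble (-a ^ 2) (a ^ 2 / (a ^ 2 - 1)) =
      (a ^ 4 - a ^ 2 + 1) ^ 2 / (4 * (a ^ 2 * (a ^ 2 - 1))) := by
  have h2 : a ^ 2 - 1 ≠ 0 := sub_ne_zero.2 h1
  rw [legendreDouble, neg_sq_mul_sub h1]
  field_simp
  ring

/-- The two x-coordinates are those of 4P and 2P. -/
theorem mem_legendreT_neg_sq_iff {a : ℂ} (h0 : a ≠ 0) (h1 : a ^ 2 ≠ 1) :
    -a ^ 2 ∈ legendreT a ↔
      -a ^ 2 ∈ legendreT ((a ^ 4 - a ^ 2 + 1) ^ 2 / (4 * (a ^ 2 * (a ^ 2 - 1)))) ∧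
      -a ^ 2 ∈ legendreT (a ^ 2 / (a ^ 2 - 1)) := by
  have h2 : a ^ 2 - 1 ≠ 0 := sub_ne_zero.2 h1
  have hx : a * (a - 1) * (a - -a ^ 2) ≠ 0 := by
    rw [show a * (a - 1) * (a - -a ^ 2) = a ^ 2 * (a ^ 2 - 1) by ring]
    positivity
  have hx' := neg_sq_mul_sub h1 ▸ div_ne_zero (pow_ne_zero 6 h0) (pow_ne_zero 3 h2)
  rw [← legendreDouble_legendreDouble_neg_sq h0 h1, mem_legendreT_double_iff hx',
    ← mem_legendreT_double_iff hx, legendreDouble_neg_sq h0 h1, and_self]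

theorem pow_add_pow_eq_zero_of_neg_sq_mem {a : ℂ} (ha : IsOfFinOrder a) (h1 : a ^ 2 ≠ 1)
    (h : -a ^ 2 ∈ legendreT a) : a ^ 8 + a ^ 4 + 1 = 0 := by
  have h0 := ha.ne_zero_complex
  have h2 : a ^ 2 - 1 ≠ 0 := sub_ne_zero.2 h1
  have hd := ((mem_legendreT_neg_sq_iff h0 h1).1 h).1
  have hi := ha.isIntegral_int
  have key : IsIntegral ℤ ((a ^ 4 - a ^ 2 + 1) / 2) := by
    refine isIntegral_half_of_forall_mem (((hi.pow 4).sub (hi.pow 2)).add isIntegral_one)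
      fun A hA => A.mem_of_sq_mem ?_
    have haA := A.mem_of_isIntegral_int hi
    have hxA := mem_valuationSubring_of_mem_legendreT hA (neg_mem (pow_mem haA 2)) hd
    have e : ((a ^ 4 - a ^ 2 + 1) / 2) ^ 2 = (a ^ 4 - a ^ 2 + 1) ^ 2 /
        (4 * (a ^ 2 * (a ^ 2 - 1))) * (a ^ 2 * (a ^ 2 - 1)) := by
      field_simp
      norm_num
    rw [e]
    exact mul_mem hxA (mul_mem (pow_mem haA 2) (sub_mem (pow_mem haA 2) A.one_mem))
  refine eq_zero_of_isIntegral_quarter ha ?_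
  -- This is a⁸ + a⁴ + 1 = (a⁴ - a² + 1)(a⁴ + a² + 1); the two factors differ by 2a², so both are
  -- divisible by 2.
  have e : (a ^ 8 + a ^ 4 + 1) / 4 =
      (a ^ 4 - a ^ 2 + 1) / 2 * ((a ^ 4 - a ^ 2 + 1) / 2 + a ^ 2) := by ring
  rw [e]
  exact key.mul (key.add (hi.pow 2))

theorem pow_twelve_eq_one {a : ℂ} (h : a ^ 8 + a ^ 4 + 1 = 0) : a ^ 12 = 1 := by
  linear_combination (a ^ 4 - 1) * h

theorem pow_four_ne_one {a : ℂ} (h : a ^ 8 + a ^ 4 + 1 = 0) : a ^ 4 ≠ 1 := by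
  intro h4
  have : (3 : ℂ) = 0 := by linear_combination h - (a ^ 4 + 2) * h4
  norm_num at this

theorem isOfFinOrder_of_pow_add_pow_eq_zero {a : ℂ} (h : a ^ 8 + a ^ 4 + 1 = 0) :
    IsOfFinOrder a :=
  isOfFinOrder_iff_pow_eq_one.2 ⟨12, by norm_num, pow_twelve_eq_one h⟩

theorem sq_ne_one_of_pow_add_pow_eq_zero {a : ℂ} (h : a ^ 8 + a ^ 4 + 1 = 0) : a ^ 2 ≠ 1 :=
  fun h2 => pow_four_ne_one h (by linear_combination (a ^ 2 + 1) * h2)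

theorem neg_sq_mem_legendreT {a : ℂ} (h : a ^ 8 + a ^ 4 + 1 = 0) : -a ^ 2 ∈ legendreT a := by
  have h0 := (isOfFinOrder_of_pow_add_pow_eq_zero h).ne_zero_complex
  have h1 := sq_ne_one_of_pow_add_pow_eq_zero h
  have h2 : a ^ 2 - 1 ≠ 0 := sub_ne_zero.2 h1
  have hl0 : -a ^ 2 ≠ 0 := neg_ne_zero.2 (pow_ne_zero 2 h0)
  have hl1 : -a ^ 2 ≠ 1 := fun e =>
    pow_four_ne_one h (by linear_combination (-(a ^ 2) + 1) * e)
  have hx := neg_sq_mul_sub h1 ▸ div_ne_zero (pow_ne_zero 6 h0) (pow_ne_zero 3 h2)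
  have hx' : a * (a - 1) * (a - -a ^ 2) ≠ 0 := by
    rw [show a * (a - 1) * (a - -a ^ 2) = a ^ 2 * (a ^ 2 - 1) by ring]
    positivity
  rw [← mem_legendreT_double_iff hx', legendreDouble_neg_sq h0 h1]
  have hf : (a ^ 4 - a ^ 2 + 1) * (a ^ 4 + a ^ 2 + 1) = 0 := by linear_combination h
  -- In the first case x(4P) = 0, a 2-torsion point; in the second x(4P) = x(2P), so 2P is
  -- 3-torsion.
  rcases mul_eq_zero.1 hf with hf | hf
  · rw [← mem_legendreT_double_iff hx, legendreDouble_legendreDouble_neg_sq h0 h1, hf]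
    exact mem_legendreT_of_root hl0 hl1 (by simp)
  · refine mem_legendreT_of_double_eq_self hl0 hl1 hx ?_
    rw [legendreDouble_legendreDouble_neg_sq h0 h1,
      show a ^ 4 - a ^ 2 + 1 = -2 * a ^ 2 by linear_combination hf]
    field_simp
    norm_num

theorem self_mem_legendreT {a : ℂ} (h0 : a ≠ 0) (h1 : a ≠ 1) : a ∈ legendreT a :=
  mem_legendreT_of_root h0 h1 (by simp)

theorem sq_mem_legendreT {a : ℂ} (h0 : a ≠ 0) (h1 : a ^ 2 ≠ 1) : a ^ 2 ∈ legendreT a := by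
  have ha1 : a ≠ 1 := fun e => h1 (by rw [e, one_pow])
  have hx := mul_sub_ne_zero (l := a ^ 2) h0 ha1 fun e =>
    ha1 (mul_left_cancel₀ h0 (by linear_combination -e))
  rw [← mem_legendreT_double_iff hx, legendreDouble_self_sq]
  exact mem_legendreT_of_root (pow_ne_zero 2 h0) h1 (by simp)

theorem orderOf_mem_iff (a : ℂ) :
    orderOf a ∈ ({3, 6, 12} : Set ℕ) ↔ a ^ 8 + a ^ 4 + 1 = 0 := by
  constructor
  · intro h
    have h12 : a ^ 12 = 1 := by
      refine orderOf_dvd_iff_pow_eq_one.1 ?_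
      rcases h with h | h | h <;> rw [h] <;> norm_num
    have h4 : a ^ 4 ≠ 1 := fun e => by
      have := orderOf_dvd_of_pow_eq_one e
      rcases h with h | h | h <;> rw [h] at this <;> norm_num at this
    refine mul_left_cancel₀ (sub_ne_zero.2 h4) ?_
    linear_combination h12
  · intro h
    have h12 := orderOf_dvd_of_pow_eq_one (pow_twelve_eq_one h)
    have h4 : ¬ orderOf a ∣ 4 := fun hd => pow_four_ne_one h (orderOf_dvd_iff_pow_eq_one.1 hd)
    have hle := Nat.le_of_dvd (by norm_num) h12
    simp only [Set.mem_insert_iff, Set.mem_singleton_iff]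
    generalize orderOf a = n at *
    interval_cases n <;> simp_all

/-! ### Intersections with the roots of unity and their sizes -/

theorem legendreT_neg_one_inter : legendreT (-1) ∩ complexRootsOfUnity = {-1} := by
  have ho : IsOfFinOrder (-1 : ℂ) := isOfFinOrder_iff_pow_eq_one.2 ⟨2, by norm_num, by norm_num⟩
  ext l
  simp only [Set.mem_inter_iff, Set.mem_singleton_iff]
  constructor
  · rintro ⟨hl, hμ⟩
    have hl1 := hl.2.1
    rcases eq_of_mem_legendreT ho (by norm_num) hμ hl with e | e | e
    · exact e
    · exact absurd (by rw [e]; norm_num) hl1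
    · rw [e]; norm_num
  · rintro rfl
    exact ⟨self_mem_legendreT (by norm_num) (by norm_num), ho⟩

theorem legendreT_inter_of_ne {a : ℂ} (ha : IsOfFinOrder a) (h1 : a ^ 2 ≠ 1)
    (h : a ^ 8 + a ^ 4 + 1 ≠ 0) : legendreT a ∩ complexRootsOfUnity = {a, a ^ 2} := by
  have ha1 : a ≠ 1 := fun e => h1 (by rw [e, one_pow])
  ext l
  simp only [Set.mem_inter_iff, Set.mem_singleton_iff, Set.mem_insert_iff]
  constructor
  · rintro ⟨hl, hμ⟩
    rcases eq_of_mem_legendreT ha ha1 hμ hl with e | e | rfl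
    · exact Or.inl e
    · exact Or.inr e
    · exact absurd (pow_add_pow_eq_zero_of_neg_sq_mem ha h1 hl) h
  · rintro (rfl | rfl)
    · exact ⟨self_mem_legendreT ha.ne_zero_complex ha1, ha⟩
    · exact ⟨sq_mem_legendreT ha.ne_zero_complex h1, ha.pow⟩

theorem legendreT_inter_of_eq {a : ℂ} (h : a ^ 8 + a ^ 4 + 1 = 0) :
    legendreT a ∩ complexRootsOfUnity = {a, a ^ 2, -a ^ 2} := by
  have ha := isOfFinOrder_of_pow_add_pow_eq_zero h
  have h1 := sq_ne_one_of_pow_add_pow_eq_zero h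
  have ha1 : a ≠ 1 := fun e => h1 (by rw [e, one_pow])
  ext l
  simp only [Set.mem_inter_iff, Set.mem_singleton_iff, Set.mem_insert_iff]
  constructor
  · rintro ⟨hl, hμ⟩
    exact eq_of_mem_legendreT ha ha1 hμ hl
  · rintro (rfl | rfl | rfl)
    · exact ⟨self_mem_legendreT ha.ne_zero_complex ha1, ha⟩
    · exact ⟨sq_mem_legendreT ha.ne_zero_complex h1, ha.pow⟩
    · refine ⟨neg_sq_mem_legendreT h, isOfFinOrder_iff_pow_eq_one.2 ⟨12, by norm_num, ?_⟩⟩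
      linear_combination (a ^ 12 + 1) * pow_twelve_eq_one h

theorem legendreT_two_inter : legendreT 2 ∩ complexRootsOfUnity = ∅ := by
  rw [Set.eq_empty_iff_forall_notMem]
  rintro l ⟨hl, hμ⟩
  have hμ' : IsOfFinOrder l := hμ
  have hn : ‖l‖ = 1 := hμ'.norm_eq_one
  have h2 : (2 : ℂ) ≠ l := fun e => by
    rw [← e] at hn
    norm_num at hn
  have hi : IsIntegral ℤ ((2 ^ 2 - l) / 2) := by
    refine isIntegral_half_of_forall_mem ?_ fun A hA => half_mem_of_mem_legendreT hA
      (A.mem_of_isIntegral_int hμ'.isIntegral_int) hl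
      (mul_sub_ne_zero two_ne_zero (by norm_num) h2)
    simpa using ((isIntegral_algebraMap (R := ℤ) (A := ℂ) (x := 2)).pow 2).sub
      hμ'.isIntegral_int
  have hlinv : IsIntegral ℤ l⁻¹ := by
    obtain ⟨n, hn', e⟩ := isOfFinOrder_iff_pow_eq_one.1 hμ'
    exact IsIntegral.of_pow hn' (by rw [inv_pow, e, inv_one]; exact isIntegral_one)
  have half : IsIntegral ℤ (1 / 2 : ℂ) := by
    have h := ((isIntegral_algebraMap (R := ℤ) (A := ℂ) (x := 2)).sub hi).mul hlinv
    have hl0 := hμ'.ne_zero_complex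
    -- Since 2 - (4 - l)/2 = l/2 and l is a unit, 1/2 would be an algebraic integer.
    have e : (algebraMap ℤ ℂ 2 - (2 ^ 2 - l) / 2) * l⁻¹ = 1 / 2 := by
      rw [← mul_inv_cancel₀ hl0]
      simp
      ring
    exact e ▸ h
  have half' : IsIntegral ℤ (1 / 2 : ℚ) := by
    refine (isIntegral_algebraMap_iff (algebraMap ℚ ℂ).injective).1 ?_
    simpa using half
  obtain ⟨n, hn⟩ := IsIntegrallyClosed.isIntegral_iff.1 half'
  have : (2 * n : ℚ) = 1 := by
    simp only [eq_intCast] at hn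
    rw [hn]; norm_num
  have : 2 * n = 1 := by exact_mod_cast this
  omega

theorem encard_pair_le {β : Type*} (x y : β) : ({x, y} : Set β).encard ≤ 2 := by
  refine (Set.encard_insert_le _ _).trans ?_
  rw [Set.encard_singleton, one_add_one_eq_two]

/-- Although a need not be an algebraic integer, a² cancels from the conditions for two parameters l
and m, leaving (l - m)/2 integral. -/
theorem legendreT_inter_encard_le_two {a : ℂ} (h0 : a ≠ 0) (h1 : a ≠ 1) (ha : ¬ IsOfFinOrder a) :
    (legendreT a ∩ complexRootsOfUnity).encard ≤ 2 := by
  rcases (legendreT a ∩ complexRootsOfUnity).eq_empty_or_nonempty with e | ⟨l, hl, hlμ⟩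
  · simp [e]
  · refine (Set.encard_le_encard (t := {l, -l}) ?_).trans (encard_pair_le _ _)
    rintro m ⟨hm, hmμ⟩
    have hlo : IsOfFinOrder l := hlμ
    have hmo : IsOfFinOrder m := hmμ
    refine eq_or_eq_neg_of_isIntegral_half_sub hlo hmo
      (isIntegral_half_of_forall_mem (hlo.isIntegral_int.sub hmo.isIntegral_int) fun A hA => ?_)
    have e1 := half_mem_of_mem_legendreT hA (A.mem_of_isIntegral_int hlo.isIntegral_int) hl
      (mul_sub_ne_zero h0 h1 fun e => ha (e ▸ hlo))
    have e2 := half_mem_of_mem_legendreT hA (A.mem_of_isIntegral_int hmo.isIntegral_int) hm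
      (mul_sub_ne_zero h0 h1 fun e => ha (e ▸ hmo))
    convert sub_mem e2 e1 using 1
    ring

theorem legendreT_inter_encard_le_two_of_ne {a : ℂ} (h0 : a ≠ 0) (h1 : a ≠ 1)
    (h : a ^ 8 + a ^ 4 + 1 ≠ 0) : (legendreT a ∩ complexRootsOfUnity).encard ≤ 2 := by
  by_cases ha : IsOfFinOrder a
  · rcases eq_or_ne (a ^ 2) 1 with h2 | h2
    · obtain rfl : a = -1 := (mul_self_eq_one_iff.1 (by rw [← sq, h2])).resolve_left h1
      rw [legendreT_neg_one_inter, Set.encard_singleton]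
      norm_num
    · rw [legendreT_inter_of_ne ha h2 h]
      exact encard_pair_le _ _
  · exact legendreT_inter_encard_le_two h0 h1 ha

theorem legendreT_inter_encard_eq_three {a : ℂ} (h : a ^ 8 + a ^ 4 + 1 = 0) :
    (legendreT a ∩ complexRootsOfUnity).encard = 3 := by
  have h0 := (isOfFinOrder_of_pow_add_pow_eq_zero h).ne_zero_complex
  have h1 := sq_ne_one_of_pow_add_pow_eq_zero h
  rw [legendreT_inter_of_eq h, Set.encard_eq_three]
  refine ⟨a, a ^ 2, -a ^ 2, fun e => h1 ?_, fun e => h1 ?_, fun e => ?_, rfl⟩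
  · have : a = 1 := mul_left_cancel₀ h0 (by linear_combination -e)
    rw [this, one_pow]
  · have : a = -1 := mul_left_cancel₀ h0 (by linear_combination e)
    rw [this]; norm_num
  · exact pow_ne_zero 2 h0 (self_eq_neg.1 e)

/-- The roots are the primitive 3rd, 6th and 12th roots of unity: 2 + 2 + 4. -/
theorem encard_setOf_pow_add_pow_eq_zero : {a : ℂ | a ^ 8 + a ^ 4 + 1 = 0}.encard = 8 := by
  have hset : {a : ℂ | a ^ 8 + a ^ 4 + 1 = 0} =
      (((primitiveRoots 3 ℂ ∪ primitiveRoots 6 ℂ) ∪ primitiveRoots 12 ℂ : Finset ℂ) : Set ℂ) := by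
    ext a
    simp only [Set.mem_ofPred_eq, ← orderOf_mem_iff, Finset.coe_union, Set.mem_union,
      Finset.mem_coe, mem_primitiveRoots (show 0 < 3 by norm_num),
      mem_primitiveRoots (show 0 < 6 by norm_num), mem_primitiveRoots (show 0 < 12 by norm_num),
      IsPrimitiveRoot.iff_orderOf, Set.mem_insert_iff, Set.mem_singleton_iff, or_assoc]
  have hd : ∀ {m n : ℕ}, m ≠ n → Disjoint (primitiveRoots m ℂ) (primitiveRoots n ℂ) :=
    fun h => IsPrimitiveRoot.disjoint h
  rw [hset, Set.encard_coe_eq_coe_finsetCard, Finset.card_union_of_disjoint,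
    Finset.card_union_of_disjoint (hd (by norm_num)), Complex.card_primitiveRoots,
    Complex.card_primitiveRoots, Complex.card_primitiveRoots]
  · rfl
  · exact Finset.disjoint_union_left.2 ⟨hd (by norm_num), hd (by norm_num)⟩

theorem mainTheorem9 :
    (∀ α : ℂ, α ∈ complexRootsOfUnity → α ≠ 1 →
      (α = -1 → legendreT α ∩ complexRootsOfUnity = {α}) ∧
      (orderOf α ∈ ({3, 6, 12} : Set ℕ) →
        legendreT α ∩ complexRootsOfUnity = {α, α ^ 2, -α ^ 2}) ∧
      (α ≠ -1 → orderOf α ∉ ({3, 6, 12} : Set ℕ) →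
        legendreT α ∩ complexRootsOfUnity = {α, α ^ 2})) ∧
    legendreT 2 ∩ complexRootsOfUnity = ∅ ∧
    IsGreatest
      {n : ℕ∞ | ∃ α : ℂ, α ≠ 0 ∧ α ≠ 1 ∧ n = (legendreT α ∩ complexRootsOfUnity).encard} 3 ∧
    (∀ α : ℂ, α ≠ 0 → α ≠ 1 →
      ((legendreT α ∩ complexRootsOfUnity).encard = 3 ↔ α ^ 8 + α ^ 4 + 1 = 0)) ∧
    {α : ℂ | α ^ 8 + α ^ 4 + 1 = 0}.encard = 8 := by
  have aux : ∀ α : ℂ, α ≠ 1 → α ≠ -1 → α ^ 2 ≠ 1 := fun α h1 h1' h2 =>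
    h1' ((mul_self_eq_one_iff.1 (by rw [← sq, h2])).resolve_left h1)
  refine ⟨fun α hα h1 => ⟨?_, fun ho => legendreT_inter_of_eq ((orderOf_mem_iff α).1 ho),
    fun h1' ho => legendreT_inter_of_ne hα (aux α h1 h1') (mt (orderOf_mem_iff α).2 ho)⟩,
    legendreT_two_inter, ⟨?_, ?_⟩, fun α h0 h1 => ⟨fun h => ?_, legendreT_inter_encard_eq_three⟩,
    encard_setOf_pow_add_pow_eq_zero⟩
  · rintro rfl
    exact legendreT_neg_one_inter
  · have hne : {a : ℂ | a ^ 8 + a ^ 4 + 1 = 0}.Nonempty := by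
      rw [← Set.encard_ne_zero, encard_setOf_pow_add_pow_eq_zero]
      norm_num
    obtain ⟨a, ha⟩ := hne
    have h1 := sq_ne_one_of_pow_add_pow_eq_zero ha
    exact ⟨a, (isOfFinOrder_of_pow_add_pow_eq_zero ha).ne_zero_complex,
      fun e => h1 (by rw [e, one_pow]), (legendreT_inter_encard_eq_three ha).symm⟩
  · rintro n ⟨a, h0, h1, rfl⟩
    by_cases h : a ^ 8 + a ^ 4 + 1 = 0
    · exact (legendreT_inter_encard_eq_three h).le
    · exact (legendreT_inter_encard_le_two_of_ne h0 h1 h).trans (by norm_num)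
  · by_contra hne
    have := legendreT_inter_encard_le_two_of_ne h0 h1 hne
    rw [h] at this
    exact absurd this (by norm_num)
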